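/- Let $p\ge 0$ and let $J:\mathbb{R}^p\to\mathbb{R}$ be a finite-valued convex function with subdifferential $\partial J$. For $\beta\in\mathbb{R}^p$ let $T_\beta=\{\rho(\eta-\eta') : \eta,\eta'\in\partial J(\beta),\ \rho\in\mathbb{R}\}^\perp$. For a set $\mathcal{M}\subset\mathbb{R}^p$ and $\beta\in\mathcal{M}$, say that $J$ is partly smooth at $\beta$ relative to $\mathcal{M}$ if (i) $\mathcal{M}$ is an (embedded) $C^2$-manifold around $\beta$ and the restriction of $J$ to $\mathcal{M}$ is $C^2$ around $\beta$; (ii) the tangent space of $\mathcal{M}$ at $\beta$ is $T_\beta$; (iii) the set-valued map $\partial J$ is continuous at $\beta$ relative to $\mathcal{M}$. Let $\beta_0\in\mathcal{M}$ and suppose that $J$ is locally partly smooth at $\beta_0$ relative to $\mathcal{M}$: $\mathcal{M}$ is a $C^2$-manifold around each of its points, and there is a neighbourhood $U$ of $\beta_0$ such that $J$ is partly smooth at every point of $\mathcal{M}\cap U$ relative to $\mathcal{M}$. Put $T=T_{\beta_0}$, let $P_T$ be the orthogonal projection onto $T$, and let $e\in\mathbb{R}^p$ be the vector with $P_T(\partial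 J(\beta_0))=\{e\}$. Suppose that $\tilde\Gamma\in\mathbb{R}^{p\times p}$ satisfies $$\ker(\tilde\Gamma)\cap T=\{0\}\quad\text{and}\quad \eta_{\tilde\Gamma}:=\tilde\Gamma\,(P_T\tilde\Gamma P_T)^+e\in\operatorname{ri}(\partial J(\beta_0)),$$ where $A^+$ is the Moore-Penrose pseudo-inverse and $\operatorname{ri}$ the relative interior. Then there exists a constant $C>0$ (depending only on $p,J,\mathcal{M},\beta_0,\tilde\Gamma$) such that the following holds for all $\mu>0$, all $u\in\mathbb{R}^p$ and all symmetric positive semidefinite $\Gamma\in\mathbb{R}^{p\times p}$ with $$\max\bigl(\|\Gamma-\tilde\Gamma\|,\ \|u-\Gamma\beta_0\|\,\mu^{-1},\ \mu\bigr)\le C,$$ where $\|\cdot\|$ is the Euclidean norm of vectors and the operator norm of matrices. For every step size $\tau>0$ with $\tau\|\Gamma\|<2$ and every starting point $b_0\in\mathbb{R}^p$, the Forward-Backward iterates $$b_{k+1}=\operatorname{Prox}_{\tau\mu J}\bigl(b_k+\tau(u-\Gamma b_k)\bigr),\qquad \operatorname{Prox}_{\gamma J}(\beta)=\operatorname*{argmin}_{\beta'\in\mathbb{R}^p}\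 \tfrac12\|\beta-\beta'\|^2+\gamma J(\beta'),$$ satisfy $b_k\in\mathcal{M}$ for all $k$ large enough. -/

import Mathlib

open Filter Topology

noncomputable section

namespace PartlySmooth

section Definitions

variable {E : Type*} [NormedAddCommGroup E] [InnerProductSpace ℝ E]

/-- The subdifferential `∂J(x)` of a finite-valued convex function `J`. -/
def subdiff (J : E → ℝ) (x : E) : Set E :=
  {η | ∀ y, J x + inner ℝ η (y - x) ≤ J y}

/-- The tangent model subspace `T_x`, the orthogonal complement of the linear space spanned by the
differences of elements of `∂J(x)`. -/
def modelSpace (J : E → ℝ) (x : E) : Submodule ℝ E :=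
  (vectorSpan ℝ (subdiff J x))ᗮ

/-- `Φ` is a `C²` local equation of the set `M` around its point `x`: near `x`, the set `M` is the
zero set of `Φ`, which is `C²` near `x` with surjective derivative at `x`. -/
structure IsLocalEquation (M : Set E) (x : E) {k : ℕ} (Φ : E → EuclideanSpace ℝ (Fin k)) :
    Prop where
  mem : x ∈ M
  contDiffAt : ContDiffAt ℝ 2 Φ x
  surjective : Function.Surjective (fderiv ℝ Φ x)
  eventually_mem_iff : ∀ᶠ y in 𝓝 x, y ∈ M ↔ Φ y = 0

/-- `M` is an (embedded) `C²`-manifold around its point `x`. -/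
def IsC2ManifoldAt (M : Set E) (x : E) : Prop :=
  ∃ (k : ℕ) (Φ : E → EuclideanSpace ℝ (Fin k)), IsLocalEquation M x Φ

/-- `M` is a `C²`-manifold around `x` and `T` is its tangent space at `x`, that is the kernel of the
derivative at `x` of a local equation (this kernel is the same for all local equations). -/
def HasTangentSpaceAt (M : Set E) (x : E) (T : Submodule ℝ E) : Prop :=
  ∃ (k : ℕ) (Φ : E → EuclideanSpace ℝ (Fin k)), IsLocalEquation M x Φ ∧
    LinearMap.ker (fderiv ℝ Φ x).toLinearMap = T

/-- The finite-valued convex function `J` is partly smooth at `x` relative to `M`. -/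
structure IsPartlySmoothAt (J : E → ℝ) (M : Set E) (x : E) : Prop where
  mem : x ∈ M
  manifold : IsC2ManifoldAt M x
  /-- The restriction of `J` to `M` is `C²` around `x`. -/
  smooth : ∃ G : E → ℝ, ContDiffAt ℝ 2 G x ∧ ∀ᶠ y in 𝓝[M] x, G y = J y
  sharp : HasTangentSpaceAt M x (modelSpace J x)
  /-- The set-valued map `∂J` is continuous at `x` relative to `M`. -/
  continuity : UpperHemicontinuousWithinAt (subdiff J) M x ∧
    LowerHemicontinuousWithinAt (subdiff J) M x

/-- `J` is locally partly smooth at `x` relative to `M`. -/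
structure IsLocallyPartlySmoothAt (J : E → ℝ) (M : Set E) (x : E) : Prop where
  mem : x ∈ M
  manifold : ∀ y ∈ M, IsC2ManifoldAt M y
  partlySmooth : ∃ U ∈ 𝓝 x, ∀ y ∈ M ∩ U, IsPartlySmoothAt J M y

/-- `Prox_{γJ}(x)`, the minimizer of `z ↦ ½‖x - z‖² + γ J(z)`. -/
def prox (γ : ℝ) (J : E → ℝ) (x : E) : E :=
  Classical.epsilon fun y =>
    ∀ z, 1 / 2 * ‖x - y‖ ^ 2 + γ * J y ≤ 1 / 2 * ‖x - z‖ ^ 2 + γ * J z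

/-- The Forward-Backward iterates with step size `τ`, started at `b`. -/
def forwardBackward (J : E → ℝ) (μ : ℝ) (u : E) (Γ : E →L[ℝ] E) (τ : ℝ) (b : E) : ℕ → E
  | 0 => b
  | k + 1 =>
    prox (τ * μ) J (forwardBackward J μ u Γ τ b k + τ • (u - Γ (forwardBackward J μ u Γ τ b k)))

variable [FiniteDimensional ℝ E]

/-- The vector `e_x` such that `P_{T_x}(∂J(x)) = {e_x}`: the projection onto `T_x` of an arbitrary
subgradient at `x`. -/
def modelVector (J : E → ℝ) (x : E) : E :=
  (modelSpace J x).starProjection (Classical.epsilon fun η => η ∈ subdiff J x)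

/-- The restriction `Γ_T = P_T Γ P_T`. -/
def compress (Γ : E →L[ℝ] E) (T : Submodule ℝ E) : E →L[ℝ] E :=
  T.starProjection ∘L Γ ∘L T.starProjection

/-- The Moore-Penrose pseudo-inverse of `A`: project orthogonally onto the range of `A`, then invert
the bijection from `(ker A)ᗮ` onto the range of `A` induced by `A`. -/
def pinv (A : E →L[ℝ] E) : E →ₗ[ℝ] E :=
  (LinearMap.ker A.toLinearMap)ᗮ.subtype ∘ₗ
    (A.toLinearMap.kerComplementEquivRange
      (LinearMap.ker A.toLinearMap).isCompl_orthogonal.symm).symm.toLinearMap ∘ₗ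
    (LinearMap.range A.toLinearMap).orthogonalProjectionOnto.toLinearMap

/-- The linearized pre-certificate `η_Γ = Γ Γ_T⁺ e` at `x`, with `T = T_x` and `e = e_x`. -/
def preCertificate (J : E → ℝ) (x : E) (Γ : E →L[ℝ] E) : E :=
  Γ (pinv (compress Γ (modelSpace J x)) (modelVector J x))

end Definitions

section WellDefined

variable {E : Type*} [NormedAddCommGroup E] [InnerProductSpace ℝ E] [FiniteDimensional ℝ E]

theorem starProjection_eq_modelVector {J : E → ℝ} {x η : E} (h : η ∈ subdiff J x) :
    (modelSpace J x).starProjection η = modelVector J x := by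
  have h' : (Classical.epsilon fun η => η ∈ subdiff J x) ∈ subdiff J x :=
    Classical.epsilon_spec (p := fun η => η ∈ subdiff J x) ⟨η, h⟩
  rw [modelVector, ← sub_eq_zero, ← map_sub, Submodule.starProjection_apply_eq_zero_iff]
  exact Submodule.le_orthogonal_orthogonal _ (vsub_mem_vectorSpan ℝ h h')

/-- The proximal point of a finite-valued convex function exists. -/
theorem prox_isMin {J : E → ℝ} (hJ : ConvexOn ℝ Set.univ J) {γ : ℝ} (hγ : 0 ≤ γ) (x z : E) :
    1 / 2 * ‖x - prox γ J x‖ ^ 2 + γ * J (prox γ J x) ≤ 1 / 2 * ‖x - z‖ ^ 2 + γ * J z := by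
  have hJc : Continuous J := hJ.locallyLipschitz.continuous
  obtain ⟨l, c, hl, hlx⟩ := hJ.exists_affine_le_of_lt (𝕜 := ℝ) (x := x) (a := J x - 1)
    (Set.mem_univ x) (by simp) isClosed_univ (hJc.lowerSemicontinuous.lowerSemicontinuousOn _)
  have hmin : ∃ y, ∀ z, 1 / 2 * ‖x - y‖ ^ 2 + γ * J y ≤ 1 / 2 * ‖x - z‖ ^ 2 + γ * J z := by
    refine Continuous.exists_forall_le' (f := fun z => 1 / 2 * ‖x - z‖ ^ 2 + γ * J z)
      (by fun_prop) x ?_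
    filter_upwards [(tendsto_norm_cocompact_atTop (E := E)).eventually_ge_atTop
      (‖x‖ + (2 * γ * ‖l‖ + 2 * γ + 1))] with z hz
    have h1 : l z + c ≤ J z := by simpa using hl ⟨z, Set.mem_univ z⟩
    have h2 : l x + c = J x - 1 := by simpa using hlx
    have h3 : l x - l z ≤ ‖l‖ * ‖x - z‖ := by
      rw [← map_sub]; exact (le_abs_self _).trans (l.le_opNorm _)
    have h4 : 2 * γ * ‖l‖ + 2 * γ + 1 ≤ ‖x - z‖ := by
      have := norm_sub_norm_le z x
      rw [norm_sub_rev] at this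
      linarith
    have h5 : 0 ≤ γ * ‖l‖ := by positivity
    have h6 : γ * (J x - 1 - ‖l‖ * ‖x - z‖) ≤ γ * J z :=
      mul_le_mul_of_nonneg_left (by linarith) hγ
    simp only [sub_self, norm_zero]
    nlinarith
  exact Classical.epsilon_spec hmin z

/-- The minimizer that defines the proximal point is unique. -/
theorem eq_prox {J : E → ℝ} (hJ : ConvexOn ℝ Set.univ J) {γ : ℝ} (hγ : 0 ≤ γ) {x y : E}
    (hy : ∀ z, 1 / 2 * ‖x - y‖ ^ 2 + γ * J y ≤ 1 / 2 * ‖x - z‖ ^ 2 + γ * J z) :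
    y = prox γ J x := by
  set q := prox γ J x
  have h1 := hy ((1 / 2 : ℝ) • y + (1 / 2 : ℝ) • q)
  have h2 := prox_isMin hJ hγ x ((1 / 2 : ℝ) • y + (1 / 2 : ℝ) • q)
  have h3 : J ((1 / 2 : ℝ) • y + (1 / 2 : ℝ) • q) ≤ 1 / 2 * J y + 1 / 2 * J q := by
    simpa using hJ.2 (Set.mem_univ y) (Set.mem_univ q) (by norm_num : (0 : ℝ) ≤ 1 / 2)
      (by norm_num : (0 : ℝ) ≤ 1 / 2) (by norm_num)
  have h4 := mul_le_mul_of_nonneg_left h3 hγ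
  have h5 := parallelogram_law_with_norm ℝ (x - y) (x - q)
  have h6 : x - y + (x - q) = (2 : ℝ) • (x - ((1 / 2 : ℝ) • y + (1 / 2 : ℝ) • q)) := by
    module
  have h7 : x - y - (x - q) = q - y := by abel
  rw [h6, h7, norm_smul, Real.norm_ofNat] at h5
  have h8 : ‖q - y‖ ^ 2 ≤ 0 := by nlinarith
  have h9 : ‖q - y‖ = 0 := by nlinarith [norm_nonneg (q - y)]
  exact (sub_eq_zero.mp (norm_eq_zero.mp h9)).symm

end WellDefined

end PartlySmooth

end

/-! Write `g = (P_T Γ' P_T)⁺ e`, so that `g ∈ T` and `η = Γ' g ∈ ri ∂J(β₀)`. Three facts combine.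

Identification (`IsPartlySmoothAt.eventually_mem`): a point near `β₀` with a subgradient near `η`
lies in `M`. Otherwise the unit directions from nearest points of `M` to such points cluster at a
unit normal `z` to `M` at `β₀`. Sharpness puts `z` in the span of `∂J(β₀) - ∂J(β₀)`, while
monotonicity and lower hemicontinuity of `∂J` along `M` make `η` maximize `⟨·, z⟩` on `∂J(β₀)`. A
relative interior point can do so only if `z = 0`.

Stability (`exists_forall_critical_mem`): if `β` minimizes the objective, then `y = (β - β₀)/μ`
stays bounded as the parameters converge, by a linear growth bound uniform in them
(`exists_growth`). Closedness of the graph and monotonicity force every limit to satisfy `Γ'(y + g)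
= 0`, so the certificate `μ⁻¹(u - Γβ)` tends to `-Γ' y = η`.

Algorithm (`eventually_forwardBackward_mem`): sufficient decrease makes steps tend to zero, so
iterates paired with their proximal subgradients accumulate only at minimizers paired with
certificates. Neither uniqueness of the minimizer nor convergence of the iterates is needed, and `C`
does not depend on the step size or starting point. -/

namespace PartlySmooth

/-! ### Subgradients and relative interiors -/

section Subdifferential

variable {E : Type*} [NormedAddCommGroup E] [InnerProductSpace ℝ E]

/-- The graph of the subdifferential of a continuous function is closed. -/
theorem mem_subdiff_of_tendsto {J : E → ℝ} (hJ : Continuous J) {ι : Type*} {l : Filter ι} [l.NeBot]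
    {x η : ι → E} {x' η' : E} (hx : Tendsto x l (𝓝 x')) (hη : Tendsto η l (𝓝 η'))
    (h : ∀ i, η i ∈ subdiff J (x i)) : η' ∈ subdiff J x' := by
  intro y
  have h1 : Tendsto (fun i => J (x i) + inner ℝ (η i) (y - x i)) l
      (𝓝 (J x' + inner ℝ η' (y - x'))) :=
    ((hJ.tendsto x').comp hx).add (hη.inner (tendsto_const_nhds.sub hx))
  exact le_of_tendsto' h1 fun i => h i y

theorem inner_sub_sub_nonneg {J : E → ℝ} {x y η ζ : E} (hη : η ∈ subdiff J x)
    (hζ : ζ ∈ subdiff J y) : 0 ≤ inner ℝ (η - ζ) (x - y) := by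
  have h1 := hη y
  have h2 := hζ x
  rw [← neg_sub x y, inner_neg_right] at h1
  rw [inner_sub_left]
  linarith

/-- A point of the relative interior can be moved in all directions of the affine span. -/
theorem exists_add_mem_of_mem_intrinsicInterior {s : Set E} {v : E}
    (hv : v ∈ intrinsicInterior ℝ s) :
    ∃ c > 0, ∀ d ∈ vectorSpan ℝ s, ‖d‖ ≤ c → v + d ∈ s := by
  obtain ⟨⟨w, hw⟩, hy, rfl⟩ := mem_intrinsicInterior.mp hv
  obtain ⟨ε, hε, hball⟩ := Metric.mem_nhds_iff.mp (mem_interior_iff_mem_nhds.mp hy)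
  refine ⟨ε / 2, by positivity, fun d hd hdε => ?_⟩
  have hmem : w + d ∈ affineSpan ℝ s := by
    have := AffineSubspace.vadd_mem_of_mem_direction (s := affineSpan ℝ s)
      (by rwa [direction_affineSpan]) hw
    rwa [vadd_eq_add, add_comm] at this
  have : (⟨w + d, hmem⟩ : affineSpan ℝ s) ∈ Metric.ball ⟨w, hw⟩ ε := by
    rw [Metric.mem_ball, Subtype.dist_eq, dist_eq_norm]
    simp only [add_sub_cancel_left]
    linarith
  exact hball this

/-- Moving `v` slightly along `z` stays in `s` and would strictly increase `⟨·, z⟩` if `z ≠ 0`. -/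
theorem eq_zero_of_forall_inner_le {s : Set E} {v z : E} (hv : v ∈ intrinsicInterior ℝ s)
    (hz : z ∈ vectorSpan ℝ s) (h : ∀ η ∈ s, inner ℝ η z ≤ inner ℝ v z) : z = 0 := by
  obtain ⟨c, hc, hs⟩ := exists_add_mem_of_mem_intrinsicInterior hv
  by_contra hz0
  have hn : 0 < ‖z‖ := norm_pos_iff.mpr hz0
  have h1 := h _ (hs ((c / ‖z‖) • z) (Submodule.smul_mem _ _ hz) (by
    rw [norm_smul, Real.norm_of_nonneg (by positivity), div_mul_cancel₀ _ hn.ne']))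
  rw [inner_add_left, real_inner_smul_left, real_inner_self_eq_norm_sq] at h1
  have : 0 < c / ‖z‖ * ‖z‖ ^ 2 := by positivity
  linarith

variable [FiniteDimensional ℝ E]

/-- Minimality of `q` against `(1 - t) q + t y`, divided by `t`, gives the subgradient inequality as
`t → 0⁺`. -/
theorem inv_smul_sub_prox_mem_subdiff {J : E → ℝ} (hJ : ConvexOn ℝ Set.univ J) {γ : ℝ}
    (hγ : 0 < γ) (x : E) : γ⁻¹ • (x - prox γ J x) ∈ subdiff J (prox γ J x) := by
  intro y
  set q := prox γ J x
  have key : ∀ t : ℝ, 0 < t → t ≤ 1 →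
      inner ℝ (x - q) (y - q) - t / 2 * ‖y - q‖ ^ 2 ≤ γ * (J y - J q) := by
    intro t ht ht1
    have h1 : 1 / 2 * ‖x - q‖ ^ 2 + γ * J q ≤ _ := prox_isMin hJ hγ.le x ((1 - t) • q + t • y)
    have h2 := mul_le_mul_of_nonneg_left (hJ.2 (Set.mem_univ q) (Set.mem_univ y)
      (by linarith : (0 : ℝ) ≤ 1 - t) ht.le (by ring)) hγ.le
    have h3 : x - ((1 - t) • q + t • y) = (x - q) - t • (y - q) := by module
    rw [h3, norm_sub_sq_real (x - q), real_inner_smul_right, norm_smul, Real.norm_of_nonneg ht.le] at h1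
    simp only [smul_eq_mul] at h2
    have h4 : t * (inner ℝ (x - q) (y - q) - t / 2 * ‖y - q‖ ^ 2) ≤ t * (γ * (J y - J q)) := by
      linarith
    exact le_of_mul_le_mul_left h4 ht
  have hlim : Tendsto (fun t : ℝ => inner ℝ (x - q) (y - q) - t / 2 * ‖y - q‖ ^ 2) (𝓝[>] 0)
      (𝓝 (inner ℝ (x - q) (y - q))) := by
    have : Continuous fun t : ℝ => inner ℝ (x - q) (y - q) - t / 2 * ‖y - q‖ ^ 2 := by fun_prop
    simpa using (this.tendsto 0).mono_left nhdsWithin_le_nhds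
  have h5 : inner ℝ (x - q) (y - q) ≤ γ * (J y - J q) := by
    refine le_of_tendsto hlim ?_
    filter_upwards [Ioc_mem_nhdsGT (zero_lt_one (α := ℝ))] with t ht using key t ht.1 ht.2
  rw [real_inner_smul_left]
  have h6 := mul_le_mul_of_nonneg_left h5 (inv_nonneg.mpr hγ.le)
  rw [inv_mul_cancel_left₀ hγ.ne'] at h6
  linarith

end Subdifferential

/-! ### Normals to the manifold and finite identification -/

section Identification

variable {E : Type*} [NormedAddCommGroup E] [InnerProductSpace ℝ E]

/-- A cluster point of unit vectors normal to `M` at points tending to `x` is orthogonal to the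
tangent space of `M` at `x`. -/
theorem mem_orthogonal_ker_of_tendsto {F : Type*} [NormedAddCommGroup F] [NormedSpace ℝ F]
    [FiniteDimensional ℝ F] {A : ℕ → E →L[ℝ] F} {A' : E →L[ℝ] F} (hA : Tendsto A atTop (𝓝 A'))
    (hsurj : Function.Surjective A') {z : ℕ → E} {z' : E} (hz : Tendsto z atTop (𝓝 z'))
    (h : ∀ n, ∃ q : (F →L[ℝ] ℝ) × ℝ, ‖q‖ = 1 ∧ ∀ t, q.1 (A n t) = q.2 * inner ℝ (z n) t) :
    z' ∈ (LinearMap.ker A'.toLinearMap)ᗮ := by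
  choose q hq1 hq using h
  obtain ⟨q', -, φ, hφ, hq'⟩ := tendsto_subseq_of_bounded (Metric.isBounded_sphere (x := 0) (r := 1))
    (fun n => mem_sphere_zero_iff_norm.mpr (hq1 n))
  have hA' := hA.comp hφ.tendsto_atTop
  have hz' := hz.comp hφ.tendsto_atTop
  have hn : ‖q'‖ = 1 := tendsto_nhds_unique hq'.norm (by simp [hq1])
  have hfst : Tendsto (fun n => (q (φ n)).1) atTop (𝓝 q'.1) := (continuous_fst.tendsto _).comp hq'
  have hsnd : Tendsto (fun n => (q (φ n)).2) atTop (𝓝 q'.2) := (continuous_snd.tendsto _).comp hq'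
  have heq : ∀ t, q'.1 (A' t) = q'.2 * inner ℝ z' t := fun t => by
    refine tendsto_nhds_unique (f := fun n => (q (φ n)).1 (A (φ n) t)) (l := atTop) ?_ ?_
    · have hAt : Tendsto (fun n => A (φ n) t) atTop (𝓝 (A' t)) :=
        ((ContinuousLinearMap.apply ℝ F t).continuous.tendsto A').comp hA'
      exact (isBoundedBilinearMap_apply.continuous.tendsto (q'.1, A' t)).comp
        (hfst.prodMk_nhds hAt)
    refine (hsnd.mul (hz'.inner (tendsto_const_nhds (x := t)))).congr fun n => ?_
    exact (hq (φ n) t).symm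
  -- The normalization survives in the limit. If the scalar part vanished, surjectivity of `A'`
  -- would kill the functional part too.
  have h0 : q'.2 ≠ 0 := by
    intro h0
    have h1 : q'.1 = 0 := by
      ext w
      obtain ⟨t, rfl⟩ := hsurj w
      simp [heq, h0]
    have : q' = 0 := Prod.ext h1 h0
    simp [this] at hn
  rw [Submodule.mem_orthogonal']
  intro t ht
  have ht' : A' t = 0 := ht
  have := heq t
  rw [ht', map_zero] at this
  exact (mul_eq_zero.mp this.symm).resolve_left h0

variable [FiniteDimensional ℝ E]

/-- First-order condition at a nearest point `y` of a level set: the normal direction is a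
Lagrange combination, with normalized multipliers. -/
theorem exists_normalized_multiplier {F : Type*} [NormedAddCommGroup F] [NormedSpace ℝ F]
    [FiniteDimensional ℝ F] {Φ : E → F} {y b : E} (hΦ : ContDiffAt ℝ 2 Φ y) (hb : b ≠ y)
    (hmin : ∀ᶠ z in 𝓝 y, Φ z = Φ y → ‖b - y‖ ≤ ‖b - z‖) :
    ∃ q : (F →L[ℝ] ℝ) × ℝ, ‖q‖ = 1 ∧
      ∀ t, q.1 (fderiv ℝ Φ y t) = q.2 * inner ℝ (‖b - y‖⁻¹ • (b - y)) t := by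
  have hΦ' : HasStrictFDerivAt Φ (fderiv ℝ Φ y) y := hΦ.hasStrictFDerivAt (by simp)
  have hφ : HasStrictFDerivAt (fun z => ‖z - b‖ ^ 2) (2 • (innerSL ℝ (y - b))) y := by
    simpa using (hasStrictFDerivAt_norm_sq (y - b)).comp y ((hasStrictFDerivAt_id y).sub_const b)
  have hext : IsLocalExtrOn (fun z => ‖z - b‖ ^ 2) {z | Φ z = Φ y} y := by
    left
    refine eventually_nhdsWithin_iff.mpr ?_
    filter_upwards [hmin] with z hz hzΦ
    have := hz hzΦ
    rw [norm_sub_rev b y, norm_sub_rev b z] at this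
    gcongr
  obtain ⟨Λ, a, hne, h⟩ := hext.exists_linear_map_of_hasStrictFDerivAt hΦ' hφ
  have hd : 0 < ‖b - y‖ := norm_pos_iff.mpr (sub_ne_zero.mpr hb)
  -- The factor `2 * ‖b - y‖` absorbs the gradient `2(y - b)` of the squared distance, so that the
  -- unit normal appears.
  set r : (F →L[ℝ] ℝ) × ℝ := (LinearMap.toContinuousLinearMap Λ, 2 * a * ‖b - y‖) with hr
  have hr0 : r ≠ 0 := by
    contrapose! hne
    rw [hr, Prod.mk_eq_zero] at hne
    refine Prod.mk_eq_zero.mpr ⟨by simpa using hne.1, ?_⟩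
    rcases mul_eq_zero.mp hne.2 with h | h
    · linarith
    · exact absurd h hd.ne'
  refine ⟨‖r‖⁻¹ • r, norm_smul_inv_norm hr0, fun t => ?_⟩
  have h1 := h t
  have h2 : inner ℝ (y - b) t = - inner ℝ (b - y) t := by
    rw [← neg_sub, inner_neg_left]
  simp only [smul_eq_mul, smul_apply, innerSL_apply_apply, h2,
    nsmul_eq_mul] at h1
  have h3 : Λ (fderiv ℝ Φ y t) = 2 * a * inner ℝ (b - y) t := by
    push_cast at h1
    linarith
  simp only [Prod.smul_fst, Prod.smul_snd, hr, smul_apply,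
    LinearMap.coe_toContinuousLinearMap', smul_eq_mul, real_inner_smul_left, h3]
  field_simp

/-- Near a point of `M`, every point has a nearest point among the points of `M` in a ball. -/
theorem IsLocalEquation.exists_nearest {M : Set E} {x : E} {k : ℕ}
    {Φ : E → EuclideanSpace ℝ (Fin k)} (h : IsLocalEquation M x Φ) :
    ∀ᶠ r in 𝓝[>] (0 : ℝ), ∀ b, ∃ y ∈ M ∩ Metric.closedBall x r,
      ∀ z ∈ M ∩ Metric.closedBall x r, ‖b - y‖ ≤ ‖b - z‖ := by
  have hev : ∀ᶠ y in 𝓝 x, ContinuousAt Φ y ∧ (y ∈ M ↔ Φ y = 0) := by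
    filter_upwards [h.contDiffAt.eventually (by simp), h.eventually_mem_iff] with y h1 h2
      using ⟨h1.continuousAt, h2⟩
  obtain ⟨ε, hε, hball⟩ := Metric.eventually_nhds_iff_ball.mp hev
  filter_upwards [Ioo_mem_nhdsGT hε] with r hr b
  have hsub : ∀ y ∈ Metric.closedBall x r, y ∈ Metric.ball x ε :=
    fun y hy => Metric.closedBall_subset_ball hr.2 hy
  have hcl : IsClosed (Metric.closedBall x r ∩ Φ ⁻¹' {0}) :=
    ContinuousOn.preimage_isClosed_of_isClosed
      (fun y hy => (hball y (hsub y hy)).1.continuousWithinAt)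
      Metric.isClosed_closedBall isClosed_singleton
  have heq : M ∩ Metric.closedBall x r = Metric.closedBall x r ∩ Φ ⁻¹' {0} := by
    ext y
    constructor
    · rintro ⟨h1, h2⟩
      exact ⟨h2, (hball y (hsub y h2)).2.mp h1⟩
    · rintro ⟨h1, h2⟩
      exact ⟨(hball y (hsub y h1)).2.mpr h2, h1⟩
  have hcpt : IsCompact (M ∩ Metric.closedBall x r) := by
    rw [heq]
    exact (isCompact_closedBall x r).of_isClosed_subset hcl Set.inter_subset_left
  obtain ⟨y, hy, hmin⟩ := hcpt.exists_isMinOn ⟨x, h.mem, Metric.mem_closedBall_self hr.1.le⟩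
    (f := fun z => ‖b - z‖) (by fun_prop)
  exact ⟨y, hy, fun z hz => hmin hz⟩

/-- Finite identification: points near `x` with a subgradient near a point of the relative interior
of `∂J(x)` belong to `M`. -/
theorem IsPartlySmoothAt.eventually_mem {J : E → ℝ} {M : Set E} {x v : E}
    (h : IsPartlySmoothAt J M x) (hv : v ∈ intrinsicInterior ℝ (subdiff J x)) :
    ∀ᶠ q : E × E in 𝓝 (x, v), q.2 ∈ subdiff J q.1 → q.1 ∈ M := by
  by_contra hcon
  obtain ⟨s, hs, hsq⟩ := exists_seq_forall_of_frequently (not_eventually.mp hcon)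
  simp only [Classical.not_imp] at hsq
  have hb : Tendsto (fun n => (s n).1) atTop (𝓝 x) := (continuous_fst.tendsto _).comp hs
  have hg : Tendsto (fun n => (s n).2) atTop (𝓝 v) := (continuous_snd.tendsto _).comp hs
  set b := fun n => (s n).1
  set g := fun n => (s n).2
  obtain ⟨k, Φ, hΦ, hker⟩ := h.sharp
  obtain ⟨r, hr, hr0 : 0 < r⟩ := (hΦ.exists_nearest.and self_mem_nhdsWithin).exists
  choose y hyM hymin using fun n => hr (b n)
  have hxm : x ∈ M ∩ Metric.closedBall x r := ⟨h.mem, Metric.mem_closedBall_self hr0.le⟩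
  -- The point `x` competes in the nearest-point problem, so `‖b n - y n‖ ≤ ‖b n - x‖`.
  have hy : Tendsto y atTop (𝓝 x) := by
    have h1 : Tendsto (fun n => b n - y n) atTop (𝓝 0) := by
      refine squeeze_zero_norm (fun n => hymin n x hxm) ?_
      simpa using (hb.sub_const x).norm
    simpa using hb.sub h1
  have hne : ∀ n, b n ≠ y n := fun n hn => (hsq n).2 (by
    change b n ∈ M
    rw [hn]
    exact (hyM n).1)
  set z := fun n => ‖b n - y n‖⁻¹ • (b n - y n) with hzdef
  have hz1 : ∀ n, ‖z n‖ = 1 := fun n => norm_smul_inv_norm (sub_ne_zero.mpr (hne n))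
  obtain ⟨z', -, φ, hφ, hz'⟩ := tendsto_subseq_of_bounded
    (Metric.isBounded_sphere (x := (0 : E)) (r := 1))
    (fun n => mem_sphere_zero_iff_norm.mpr (hz1 n))
  have hn1 : ‖z'‖ = 1 := tendsto_nhds_unique hz'.norm (by simp [hz1])
  have hyφ := hy.comp hφ.tendsto_atTop
  have hgφ := hg.comp hφ.tendsto_atTop
  have hev : ∀ᶠ w in 𝓝 x, ContDiffAt ℝ 2 Φ w ∧ (∀ᶠ w' in 𝓝 w, w' ∈ M ↔ Φ w' = 0) ∧
      w ∈ Metric.ball x r := by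
    filter_upwards [hΦ.contDiffAt.eventually (by simp), hΦ.eventually_mem_iff.eventually_nhds,
      Metric.ball_mem_nhds x hr0] with w h1 h2 h3 using ⟨h1, h2, h3⟩
  obtain ⟨N, hN⟩ := eventually_atTop.mp (hyφ.eventually hev)
  have hshift : Tendsto (fun n => n + N) atTop atTop := tendsto_add_atTop_nat N
  have hzorth : z' ∈ (LinearMap.ker (fderiv ℝ Φ x).toLinearMap)ᗮ := by
    have hcont : ContinuousAt (fderiv ℝ Φ) x :=
      (hΦ.contDiffAt.fderiv_right (m := 1) (by norm_num)).continuousAt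
    refine mem_orthogonal_ker_of_tendsto (hcont.tendsto.comp (hyφ.comp hshift)) hΦ.surjective
      (hz'.comp hshift) fun n => ?_
    obtain ⟨h1, h2, h3⟩ := hN (n + N) (by omega)
    refine exists_normalized_multiplier h1 (hne _) ?_
    filter_upwards [h2, Metric.isOpen_ball.mem_nhds h3] with w hw hwb hwΦ
    refine hymin _ w ⟨hw.mpr ?_, Metric.ball_subset_closedBall hwb⟩
    rw [hwΦ]
    exact h2.self_of_nhds.mp (hyM _).1
  -- Sharpness: normals to `M` at `x` are exactly the span of differences of subgradients.
  have hspan : z' ∈ vectorSpan ℝ (subdiff J x) := by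
    rw [hker, modelSpace, Submodule.orthogonal_orthogonal] at hzorth
    exact hzorth
  have hz0 : z' = 0 := by
    refine eq_zero_of_forall_inner_le hv hspan fun η hη => le_of_forall_pos_le_add fun ε hε => ?_
    -- Each `η ∈ ∂J(x)` is approximated by `ζ ∈ ∂J(y n)`, to which monotonicity against `g n ∈ ∂J(b
    -- n)` applies.
    have hl := lowerHemicontinuousWithinAt_iff.mp h.continuity.2 (Metric.ball η ε)
      Metric.isOpen_ball ⟨η, hη, Metric.mem_ball_self hε⟩
    have hyM' : Tendsto (y ∘ φ) atTop (𝓝[M] x) :=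
      tendsto_nhdsWithin_iff.mpr ⟨hyφ, Eventually.of_forall fun n => (hyM _).1⟩
    refine le_of_tendsto_of_tendsto (tendsto_const_nhds.inner hz')
      ((hgφ.inner hz').add_const ε) ?_
    filter_upwards [hyM'.eventually hl] with n hn
    obtain ⟨ζ, hζ, hζε⟩ := hn
    have h1 : 0 ≤ inner ℝ (g (φ n) - ζ) (z (φ n)) := by
      rw [hzdef, real_inner_smul_right]
      exact mul_nonneg (by positivity) (inner_sub_sub_nonneg (hsq (φ n)).1 hζ)
    have h2 : inner ℝ (η - ζ) (z (φ n)) ≤ ε := by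
      refine (real_inner_le_norm _ _).trans ?_
      rw [hz1, mul_one, ← dist_eq_norm, dist_comm]
      exact (Metric.mem_ball.mp hζε).le
    rw [inner_sub_left] at h1 h2
    simp only [Function.comp_apply]
    linarith
  simp [hz0] at hn1

end Identification

/-! ### The quadratic objective and positive operators -/

section Objective

variable {E : Type*} [NormedAddCommGroup E] [InnerProductSpace ℝ E]

/-- The objective `½⟨Γβ, β⟩ - ⟨u, β⟩ + μ J(β)` whose minimizers the Forward-Backward iteration
computes. -/
noncomputable def objective (J : E → ℝ) (μ : ℝ) (u : E) (Γ : E →L[ℝ] E) (β : E) : ℝ :=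
  1 / 2 * inner ℝ (Γ β) β - inner ℝ u β + μ * J β

theorem objective_add {J : E → ℝ} {μ : ℝ} {u : E} {Γ : E →L[ℝ] E} (hΓ : Γ.IsPositive) (β h : E) :
    objective J μ u Γ (β + h) = objective J μ u Γ β - inner ℝ (u - Γ β) h
      + 1 / 2 * inner ℝ (Γ h) h + μ * (J (β + h) - J β) := by
  have hs : inner ℝ (Γ h) β = inner ℝ (Γ β) h := by
    rw [real_inner_comm]
    exact (hΓ.isSymmetric β h).symm
  simp only [objective, map_add, inner_add_left, inner_add_right, inner_sub_left, hs]
  ring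

/-- A solution of the optimality condition minimizes the objective. -/
theorem objective_le_of_mem_subdiff {J : E → ℝ} {μ : ℝ} (hμ : 0 < μ) {u : E} {Γ : E →L[ℝ] E}
    (hΓ : Γ.IsPositive) {β : E} (hβ : μ⁻¹ • (u - Γ β) ∈ subdiff J β) (z : E) :
    objective J μ u Γ β ≤ objective J μ u Γ z := by
  have h1 := objective_add (J := J) (μ := μ) (u := u) hΓ β (z - β)
  have h2 := hβ z
  have h3 := hΓ.inner_nonneg_left (z - β)
  rw [add_sub_cancel] at h1
  rw [real_inner_smul_left] at h2
  have h4 := mul_le_mul_of_nonneg_left h2 hμ.le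
  rw [mul_add, mul_inv_cancel_left₀ hμ.ne'] at h4
  linarith

/-- Positivity at `x - t Γx` reads `0 ≤ t² a - 2 t s`. For `t = s / (a + 1)` the right side is `-t²
(a + 2)`, so `t = 0`; the `1` keeps the denominator positive. -/
theorem map_eq_zero_of_inner_map_self_eq_zero {Γ : E →L[ℝ] E} (hΓ : Γ.IsPositive) {x : E}
    (h : inner ℝ (Γ x) x = 0) : Γ x = 0 := by
  set s := ‖Γ x‖ ^ 2 with hs
  set a := inner ℝ (Γ (Γ x)) (Γ x) with ha
  have ha0 : 0 ≤ a := hΓ.inner_nonneg_left _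
  have h1 := hΓ.inner_nonneg_left (x - (s / (a + 1)) • Γ x)
  have h2 : inner ℝ (Γ (Γ x)) x = s := by
    rw [hs, ← real_inner_self_eq_norm_sq]
    exact hΓ.isSymmetric (Γ x) x
  simp only [map_sub, map_smul, inner_sub_left, inner_sub_right, real_inner_smul_left,
    real_inner_smul_right, h, h2, real_inner_self_eq_norm_sq, ← hs, ← ha] at h1
  have h3 : s / (a + 1) * (a + 1) = s := div_mul_cancel₀ _ (by positivity)
  have h4 : s ^ 2 ≤ 0 := by
    have h5 : 0 ≤ (s / (a + 1)) ^ 2 := by positivity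
    have h6 : s / (a + 1) * s = (s / (a + 1)) ^ 2 * (a + 1) := by
      nth_rewrite 2 [← h3]
      ring
    have h7 : (s / (a + 1)) ^ 2 = 0 := by nlinarith
    have h8 : s / (a + 1) = 0 := by simpa using h7
    rw [← h3, h8]
    simp
  have h5 : s = 0 := by nlinarith
  simpa [hs] using h5

/-- This makes the main claim vacuous for small `C` when `Γ'` is not positive. -/
theorem isClosed_setOf_isPositive : IsClosed {Γ : E →L[ℝ] E | Γ.IsPositive} := by
  have : {Γ : E →L[ℝ] E | Γ.IsPositive} =
      (⋂ x, ⋂ y, {Γ | inner ℝ (Γ x) y = inner ℝ x (Γ y)}) ∩ ⋂ x, {Γ | 0 ≤ inner ℝ (Γ x) x} := by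
    ext Γ
    simp only [Set.mem_ofPred_eq, Set.mem_inter_iff, Set.mem_iInter]
    exact ⟨fun h => ⟨fun x y => h.isSymmetric x y, fun x => h.inner_nonneg_left x⟩,
      fun h => ⟨fun x y => h.1 x y, fun x => h.2 x⟩⟩
  rw [this]
  refine IsClosed.inter ?_ ?_
  · refine isClosed_iInter fun x => isClosed_iInter fun y => isClosed_eq ?_ ?_ <;> fun_prop
  · refine isClosed_iInter fun x => isClosed_le ?_ ?_ <;> fun_prop

end Objective

/-! ### Uniform growth and blow-up of the solutions at `β₀` -/

section Growth

variable {E : Type*} [NormedAddCommGroup E] [InnerProductSpace ℝ E] [FiniteDimensional ℝ E]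

/-- The support function of the `c`-ball of `V` is `c ‖P_V ·‖`, and it is attained. -/
theorem exists_mem_inner_eq_mul_norm_starProjection (V : Submodule ℝ E) {c : ℝ} (hc : 0 ≤ c)
    (k : E) : ∃ d ∈ V, ‖d‖ ≤ c ∧ inner ℝ d k = c * ‖V.starProjection k‖ := by
  set q := V.starProjection k with hq
  have hqV : q ∈ V := V.starProjection_apply_mem k
  have hqk : inner ℝ q k = ‖q‖ ^ 2 := by
    have h1 := V.starProjection_inner_eq_zero k q hqV
    rw [← hq, inner_sub_left, real_inner_self_eq_norm_sq, real_inner_comm] at h1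
    linarith
  rcases eq_or_ne q 0 with h0 | h0
  · exact ⟨0, V.zero_mem, by simpa using hc, by simp [h0]⟩
  · have hn : ‖q‖ ≠ 0 := norm_ne_zero_iff.mpr h0
    refine ⟨(c / ‖q‖) • q, V.smul_mem _ hqV, ?_, ?_⟩
    · rw [norm_smul, Real.norm_of_nonneg (by positivity), div_mul_cancel₀ _ hn]
    · rw [real_inner_smul_left, hqk]
      field_simp

/-- Compactness of the sphere reduces this to positivity. A zero would lie in both `ker Γ'` and
`Vᗮ`. -/
theorem exists_le_add_norm_starProjection {V : Submodule ℝ E} {Γ' : E →L[ℝ] E}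
    (hΓ' : Γ'.IsPositive) (hker : LinearMap.ker Γ'.toLinearMap ⊓ Vᗮ = ⊥) {c : ℝ} (hc : 0 < c) :
    ∃ α > 0, ∀ k : E, ‖k‖ = 1 → α ≤ 1 / 2 * inner ℝ (Γ' k) k + c * ‖V.starProjection k‖ := by
  have hpos : ∀ k : E, ‖k‖ = 1 → 0 < 1 / 2 * inner ℝ (Γ' k) k + c * ‖V.starProjection k‖ := by
    intro k hk
    have h1 := hΓ'.inner_nonneg_left k
    have h2 : 0 ≤ c * ‖V.starProjection k‖ := by positivity
    by_contra hcon
    have h3 : Γ' k = 0 := map_eq_zero_of_inner_map_self_eq_zero hΓ' (by linarith)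
    have h4 : V.starProjection k = 0 := by
      have : c * ‖V.starProjection k‖ = 0 := by linarith
      simpa [hc.ne'] using this
    have h5 : k ∈ LinearMap.ker Γ'.toLinearMap ⊓ Vᗮ :=
      ⟨h3, (Submodule.starProjection_apply_eq_zero_iff V).mp h4⟩
    rw [hker, Submodule.mem_bot] at h5
    simp [h5] at hk
  rcases (Metric.sphere (0 : E) 1).eq_empty_or_nonempty with he | hne
  · refine ⟨1, one_pos, fun k hk => ?_⟩
    have : k ∈ Metric.sphere (0 : E) 1 := mem_sphere_zero_iff_norm.mpr hk
    simp [he] at this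
  · obtain ⟨k₀, hk₀, hmin⟩ := (isCompact_sphere (0 : E) 1).exists_isMinOn hne
      (f := fun k => 1 / 2 * inner ℝ (Γ' k) k + c * ‖V.starProjection k‖)
      (by fun_prop)
    exact ⟨_, hpos k₀ (mem_sphere_zero_iff_norm.mp hk₀),
      fun k hk => hmin (mem_sphere_zero_iff_norm.mpr hk)⟩

/-- Replacing `Γ'` by `Γ` costs at most `α / 2` on the unit sphere. Beyond it the quadratic term
dominates its linear rescaling; inside it the left side is nonpositive. -/
theorem mul_norm_sub_one_le {V : Submodule ℝ E} {Γ Γ' : E →L[ℝ] E} (hΓ : Γ.IsPositive) {c α : ℝ}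
    (hc : 0 < c) (hα : 0 < α)
    (h : ∀ k : E, ‖k‖ = 1 → α ≤ 1 / 2 * inner ℝ (Γ' k) k + c * ‖V.starProjection k‖)
    (hΓΓ' : ‖Γ - Γ'‖ ≤ α) (k : E) :
    α / 2 * (‖k‖ - 1) ≤ 1 / 2 * inner ℝ (Γ k) k + c * ‖V.starProjection k‖ := by
  have h1 := hΓ.inner_nonneg_left k
  have h2 : 0 ≤ c * ‖V.starProjection k‖ := by positivity
  rcases le_or_gt ‖k‖ 1 with hk | hk
  · nlinarith
  have hk0 : 0 < ‖k‖ := by linarith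
  obtain ⟨z, hz1, hkz⟩ : ∃ z : E, ‖z‖ = 1 ∧ k = ‖k‖ • z :=
    ⟨‖k‖⁻¹ • k, norm_smul_inv_norm (norm_pos_iff.mp hk0), by rw [smul_inv_smul₀ hk0.ne']⟩
  have h3 := h z hz1
  have h4 : inner ℝ (Γ' z) z - inner ℝ (Γ z) z ≤ α := by
    have h5 : inner ℝ ((Γ' - Γ) z) z ≤ ‖Γ' - Γ‖ * ‖z‖ * ‖z‖ :=
      (real_inner_le_norm _ _).trans (by gcongr; exact ContinuousLinearMap.le_opNorm _ _)
    rw [sub_apply, inner_sub_left, norm_sub_rev, hz1] at h5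
    linarith
  have h6 := hΓ.inner_nonneg_left z
  have h7 : inner ℝ (Γ k) k = ‖k‖ ^ 2 * inner ℝ (Γ z) z := by
    conv_lhs => rw [hkz]
    rw [map_smul, real_inner_smul_left, real_inner_smul_right]
    ring
  have h8 : ‖V.starProjection k‖ = ‖k‖ * ‖V.starProjection z‖ := by
    conv_lhs => rw [hkz]
    rw [map_smul, norm_smul, norm_norm]
  rw [h7, h8]
  have h9 : ‖k‖ * inner ℝ (Γ z) z ≤ ‖k‖ ^ 2 * inner ℝ (Γ z) z :=
    mul_le_mul_of_nonneg_right (by nlinarith) h6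
  have h10 : ‖k‖ * (α / 2) ≤ ‖k‖ * (1 / 2 * inner ℝ (Γ z) z + c * ‖V.starProjection z‖) :=
    mul_le_mul_of_nonneg_left (by linarith) hk0.le
  nlinarith

/-- Uniform linear growth of the objective around `β₀`, in the scaled variable `y`. -/
theorem exists_growth {J : E → ℝ} {β₀ g : E} {V : Submodule ℝ E} {Γ' : E →L[ℝ] E}
    (hΓ' : Γ'.IsPositive) (hker : LinearMap.ker Γ'.toLinearMap ⊓ Vᗮ = ⊥) {c : ℝ} (hc : 0 < c)
    (hg : g ∈ Vᗮ) (hs : ∀ d ∈ V, ‖d‖ ≤ c → Γ' g + d ∈ subdiff J β₀) :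
    ∃ C > 0, ∃ a > 0, ∃ A : ℝ, ∀ (μ : ℝ) (u : E) (Γ : E →L[ℝ] E), 0 < μ → Γ.IsPositive →
      ‖Γ - Γ'‖ ≤ C → ‖u - Γ β₀‖ * μ⁻¹ ≤ C → ∀ y : E,
      objective J μ u Γ β₀ + μ ^ 2 * (a * ‖y‖ - A) ≤ objective J μ u Γ (β₀ + μ • y) := by
  obtain ⟨α, hα, hsph⟩ := exists_le_add_norm_starProjection hΓ' hker hc
  have hg1 : 0 < 1 + ‖g‖ := by positivity
  -- The errors in `u` and `Γ` cost `C (1 + ‖g‖) ‖y‖ = α / 4 * ‖y‖`, half of the available rate `α /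
  -- 2`.
  refine ⟨α / 4 / (1 + ‖g‖), by positivity, α / 4, by positivity,
    α / 2 * (‖g‖ + 1) + 1 / 2 * ((‖Γ'‖ + α) * ‖g‖ * ‖g‖), ?_⟩
  intro μ u Γ hμ hΓ h1 h2 y
  set C := α / 4 / (1 + ‖g‖)
  have hC : C * (1 + ‖g‖) = α / 4 := div_mul_cancel₀ _ hg1.ne'
  have hC0 : 0 < C := by positivity
  have hCα : C ≤ α := by nlinarith [norm_nonneg g]
  -- Shifting by `g` completes the square for the linear term `⟨Γ g, y⟩`, and `P_V` does not see the
  -- shift since `g ∈ Vᗮ`.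
  have hquad := mul_norm_sub_one_le hΓ hc hα hsph (h1.trans hCα) (y + g)
  have hproj : V.starProjection (y + g) = V.starProjection y := by
    rw [map_add, (Submodule.starProjection_apply_eq_zero_iff V).mpr hg, add_zero]
  rw [hproj] at hquad
  have hJ : μ * inner ℝ (Γ' g) y + μ * (c * ‖V.starProjection y‖) ≤ J (β₀ + μ • y) - J β₀ := by
    obtain ⟨d, hd, hdc, hdy⟩ := exists_mem_inner_eq_mul_norm_starProjection V hc.le y
    have := hs d hd hdc (β₀ + μ • y)
    rw [add_sub_cancel_left, real_inner_smul_right, inner_add_left, hdy] at this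
    linarith
  have hu : inner ℝ (u - Γ β₀) y ≤ C * μ * ‖y‖ := by
    refine (real_inner_le_norm _ _).trans (mul_le_mul_of_nonneg_right ?_ (norm_nonneg _))
    rwa [← div_eq_mul_inv, div_le_iff₀ hμ] at h2
  have hpert : inner ℝ (Γ g) y - inner ℝ (Γ' g) y ≤ C * ‖g‖ * ‖y‖ := by
    rw [← inner_sub_left, ← sub_apply]
    refine (real_inner_le_norm _ _).trans (mul_le_mul_of_nonneg_right ?_ (norm_nonneg _))
    exact ContinuousLinearMap.le_of_opNorm_le _ h1 g
  have hgg : inner ℝ (Γ g) g ≤ (‖Γ'‖ + α) * ‖g‖ * ‖g‖ := by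
    refine (real_inner_le_norm _ _).trans (mul_le_mul_of_nonneg_right ?_ (norm_nonneg _))
    refine ContinuousLinearMap.le_of_opNorm_le _ ?_ g
    have := norm_add_le (Γ - Γ') Γ'
    rw [sub_add_cancel] at this
    linarith
  have hsym : inner ℝ (Γ y) g = inner ℝ (Γ g) y := by
    rw [real_inner_comm]
    exact (hΓ.isSymmetric g y).symm
  have hexp : inner ℝ (Γ (y + g)) (y + g) =
      inner ℝ (Γ y) y + 2 * inner ℝ (Γ g) y + inner ℝ (Γ g) g := by
    simp only [map_add, inner_add_left, inner_add_right, hsym]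
    ring
  have hnorm : ‖y‖ ≤ ‖y + g‖ + ‖g‖ := by simpa using norm_sub_le (y + g) g
  have hbr : α / 4 * ‖y‖ - (α / 2 * (‖g‖ + 1) + 1 / 2 * ((‖Γ'‖ + α) * ‖g‖ * ‖g‖)) ≤
      1 / 2 * inner ℝ (Γ y) y + inner ℝ (Γ' g) y + c * ‖V.starProjection y‖ - C * ‖y‖ := by
    have e1 : α / 2 * ‖y‖ ≤ α / 2 * (‖y + g‖ + ‖g‖) :=
      mul_le_mul_of_nonneg_left hnorm (by positivity)
    have e2 : C * ‖y‖ + C * ‖g‖ * ‖y‖ = α / 4 * ‖y‖ := by rw [← hC]; ring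
    rw [hexp] at hquad
    linarith
  rw [objective_add hΓ]
  have e3 := mul_le_mul_of_nonneg_left hbr (sq_nonneg μ)
  have e4 := mul_le_mul_of_nonneg_left hJ hμ.le
  have e5 := mul_le_mul_of_nonneg_left hu hμ.le
  simp only [map_smul, real_inner_smul_left, real_inner_smul_right]
  linarith

/-- The limit of the scaled deviations of solutions from `β₀` has dual certificate `Γ' g`. -/
theorem map_add_eq_zero_of_forall_inner_nonneg {J : E → ℝ} {β₀ g y : E} {Γ' : E →L[ℝ] E}
    (hΓ' : Γ'.IsPositive) (hg : g ∈ modelSpace J β₀)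
    (hη : Γ' g ∈ intrinsicInterior ℝ (subdiff J β₀)) (hy : -Γ' y ∈ subdiff J β₀)
    (hmono : ∀ ζ ∈ subdiff J β₀, 0 ≤ inner ℝ (-Γ' y - ζ) y) : Γ' (y + g) = 0 := by
  obtain ⟨c, hc, hs⟩ := exists_add_mem_of_mem_intrinsicInterior hη
  set V := vectorSpan ℝ (subdiff J β₀)
  have hgV : ∀ w ∈ V, inner ℝ w g = 0 := fun w hw => Submodule.inner_right_of_mem_orthogonal hw hg
  obtain ⟨d, hd, hdc, hdk⟩ := exists_mem_inner_eq_mul_norm_starProjection V hc.le (y + g)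
  have hkV : Γ' (y + g) ∈ V := by
    have := vsub_mem_vectorSpan ℝ (intrinsicInterior_subset hη) hy
    rw [vsub_eq_sub] at this
    convert this using 1
    rw [map_add]
    abel
  have h1 := hmono _ (hs d hd hdc)
  -- The vector `Γ' (y + g) + d` lies in `V`, hence is orthogonal to `g`, and `y` may be replaced by
  -- `y + g`. Monotonicity then bounds a sum of two nonnegative terms by zero.
  have h2 : inner ℝ (-Γ' y - (Γ' g + d)) y =
      -inner ℝ (Γ' (y + g)) (y + g) - inner ℝ d (y + g) := by
    have h3 : -Γ' y - (Γ' g + d) = -(Γ' (y + g) + d) := by rw [map_add]; abel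
    have h4 := hgV _ (V.add_mem hkV hd)
    rw [h3, ← neg_add', ← inner_add_left, inner_neg_left, inner_add_right _ y g, h4, add_zero]
  have h5 := hΓ'.inner_nonneg_left (y + g)
  have h6 : 0 ≤ c * ‖V.starProjection (y + g)‖ := by positivity
  rw [h2, hdk] at h1
  exact map_eq_zero_of_inner_map_self_eq_zero hΓ' (by linarith)

/-- Solutions for parameters near `(Γ', Γ β₀, 0)` are near `β₀`, with a dual certificate near
`Γ' g`. -/
theorem exists_forall_critical_mem {J : E → ℝ} (hJ : Continuous J) {β₀ g : E} {Γ' : E →L[ℝ] E}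
    (hΓ' : Γ'.IsPositive) (hker : LinearMap.ker Γ'.toLinearMap ⊓ modelSpace J β₀ = ⊥)
    (hg : g ∈ modelSpace J β₀) (hη : Γ' g ∈ intrinsicInterior ℝ (subdiff J β₀)) {O : Set (E × E)}
    (hO : O ∈ 𝓝 (β₀, Γ' g)) :
    ∃ C > 0, ∀ (μ : ℝ) (u : E) (Γ : E →L[ℝ] E), 0 < μ → Γ.IsPositive → ‖Γ - Γ'‖ ≤ C →
      ‖u - Γ β₀‖ * μ⁻¹ ≤ C → μ ≤ C → ∀ β, μ⁻¹ • (u - Γ β) ∈ subdiff J β →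
      (β, μ⁻¹ • (u - Γ β)) ∈ O := by
  obtain ⟨c, hc, hs⟩ := exists_add_mem_of_mem_intrinsicInterior hη
  obtain ⟨C₀, hC₀, a, ha, A, hgrow⟩ := exists_growth hΓ' hker hc hg hs
  by_contra! hcon
  choose μ u Γ hμ hΓ hΓC huC hμC β hβ hβO using fun n : ℕ =>
    hcon (min C₀ (1 / (n + 1))) (lt_min hC₀ (by positivity))
  have hlim : Tendsto (fun n : ℕ => min C₀ (1 / ((n : ℝ) + 1))) atTop (𝓝 0) := by
    have := (tendsto_const_nhds (x := C₀)).min (tendsto_one_div_add_atTop_nhds_zero_nat (𝕜 := ℝ))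
    rwa [min_eq_right hC₀.le] at this
  set w := fun n => (μ n)⁻¹ • (u n - Γ n β₀) with hw
  set y := fun n => (μ n)⁻¹ • (β n - β₀) with hy
  have hβy : ∀ n, β n = β₀ + μ n • y n := fun n => by
    rw [hy, smul_inv_smul₀ (hμ n).ne', add_sub_cancel]
  have hvy : ∀ n, (μ n)⁻¹ • (u n - Γ n (β n)) = w n - Γ n (y n) := fun n => by
    rw [hw, hy, map_smul, ← smul_sub, map_sub]
    congr 1
    abel
  have hwlim : Tendsto w atTop (𝓝 0) := by
    refine squeeze_zero_norm (fun n => ?_) hlim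
    rw [hw, norm_smul, Real.norm_of_nonneg (inv_nonneg.mpr (hμ n).le), mul_comm]
    exact huC n
  have hΓlim : Tendsto Γ atTop (𝓝 Γ') := by
    rw [tendsto_iff_norm_sub_tendsto_zero]
    exact squeeze_zero (fun n => norm_nonneg _) hΓC hlim
  have hμlim : Tendsto μ atTop (𝓝 0) := squeeze_zero (fun n => (hμ n).le) hμC hlim
  -- A solution does at least as well as `β₀`, so the growth bound forces `a ‖y n‖ ≤ A`.
  have hybd : ∀ n, y n ∈ Metric.closedBall (0 : E) (A / a) := fun n => by
    have h1 := hgrow (μ n) (u n) (Γ n) (hμ n) (hΓ n) ((hΓC n).trans (min_le_left _ _))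
      ((huC n).trans (min_le_left _ _)) (y n)
    rw [← hβy] at h1
    have h2 := objective_le_of_mem_subdiff (hμ n) (hΓ n) (hβ n) β₀
    have h3 : a * ‖y n‖ - A ≤ 0 := by
      by_contra h
      have : 0 < (μ n) ^ 2 * (a * ‖y n‖ - A) := mul_pos (pow_pos (hμ n) 2) (not_le.mp h)
      linarith
    rw [mem_closedBall_zero_iff, le_div_iff₀ ha]
    linarith
  obtain ⟨y', -, φ, hφ, hy'⟩ := tendsto_subseq_of_bounded Metric.isBounded_closedBall hybd
  have hφt := hφ.tendsto_atTop
  have hβlim : Tendsto (fun n => β (φ n)) atTop (𝓝 β₀) := by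
    have : Tendsto (fun n => β₀ + μ (φ n) • y (φ n)) atTop (𝓝 (β₀ + (0 : ℝ) • y')) :=
      tendsto_const_nhds.add ((hμlim.comp hφt).smul hy')
    rw [zero_smul, add_zero] at this
    exact this.congr fun n => (hβy _).symm
  have hvlim : Tendsto (fun n => (μ (φ n))⁻¹ • (u (φ n) - Γ (φ n) (β (φ n)))) atTop
      (𝓝 (-Γ' y')) := by
    have h1 : Tendsto (fun n => Γ (φ n) (y (φ n))) atTop (𝓝 (Γ' y')) :=
      (isBoundedBilinearMap_apply.continuous.tendsto (Γ', y')).comp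
        ((hΓlim.comp hφt).prodMk_nhds hy')
    have h2 := (hwlim.comp hφt).sub h1
    rw [zero_sub] at h2
    exact h2.congr fun n => (hvy _).symm
  have hzero : Γ' (y' + g) = 0 := by
    refine map_add_eq_zero_of_forall_inner_nonneg hΓ' hg hη
      (mem_subdiff_of_tendsto hJ hβlim hvlim fun n => hβ _) fun ζ hζ => ?_
    refine ge_of_tendsto' ((hvlim.sub_const ζ).inner hy') fun n => ?_
    have h1 := inner_sub_sub_nonneg (hβ (φ n)) hζ
    simp only [Function.comp_apply, hy, real_inner_smul_right]
    exact mul_nonneg (inv_nonneg.mpr (hμ _).le) h1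
  have hval : -Γ' y' = Γ' g := by
    rw [map_add] at hzero
    exact neg_eq_of_add_eq_zero_right hzero
  rw [hval] at hvlim
  obtain ⟨n, hn⟩ := ((hβlim.prodMk_nhds hvlim).eventually hO).exists
  exact hβO _ hn

/-- The values of the pseudo-inverse lie in `(ker)ᗮ`, and the kernel of the compression contains
`Tᗮ`. -/
theorem pinv_compress_mem (Γ : E →L[ℝ] E) (T : Submodule ℝ E) (x : E) :
    pinv (compress Γ T) x ∈ T := by
  have h1 : pinv (compress Γ T) x ∈ (LinearMap.ker (compress Γ T).toLinearMap)ᗮ :=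
    Subtype.property _
  have h2 : Tᗮ ≤ LinearMap.ker (compress Γ T).toLinearMap := fun z hz => by
    have : T.starProjection z = 0 := (Submodule.starProjection_apply_eq_zero_iff T).mpr hz
    simp [compress, this]
  simpa using Submodule.orthogonal_le h2 h1

end Growth

/-! ### Forward-Backward descent and the conclusion -/

section ForwardBackward

variable {E : Type*} [NormedAddCommGroup E] [InnerProductSpace ℝ E] [FiniteDimensional ℝ E]

/-- The pairs formed by a Forward-Backward iterate and the subgradient that its proximal step
provides are eventually in every open set that contains the pairs of the solutions. -/
theorem eventually_forwardBackward_mem {J : E → ℝ} (hJ : ConvexOn ℝ Set.univ J) {μ : ℝ}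
    (hμ : 0 < μ) {u : E} {Γ : E →L[ℝ] E} (hΓ : Γ.IsPositive) {τ : ℝ} (hτ : 0 < τ)
    (hτΓ : τ * ‖Γ‖ < 2) (hcoer : Tendsto (objective J μ u Γ) (cocompact E) atTop)
    {O : Set (E × E)} (hO : IsOpen O)
    (hcrit : ∀ β, μ⁻¹ • (u - Γ β) ∈ subdiff J β → (β, μ⁻¹ • (u - Γ β)) ∈ O) (b₀ : E) :
    ∀ᶠ k in atTop, ∃ g ∈ subdiff J (forwardBackward J μ u Γ τ b₀ (k + 1)),
      (forwardBackward J μ u Γ τ b₀ (k + 1), g) ∈ O := by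
  have hJc : Continuous J := hJ.locallyLipschitz.continuous
  set b := forwardBackward J μ u Γ τ b₀ with hb
  set F := objective J μ u Γ with hF
  set g : ℕ → E := fun k => (τ * μ)⁻¹ • (b k + τ • (u - Γ (b k)) - b (k + 1)) with hg
  have hsub : ∀ k, g k ∈ subdiff J (b (k + 1)) := fun k =>
    inv_smul_sub_prox_mem_subdiff hJ (mul_pos hτ hμ) (b k + τ • (u - Γ (b k)))
  -- The proximal step gains `τ⁻¹ ‖d‖²` and the curvature of the quadratic part loses at most `‖Γ‖ /
  -- 2 * ‖d‖²`; `τ ‖Γ‖ < 2` makes the balance positive.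
  set δ := τ⁻¹ - ‖Γ‖ / 2 with hδ
  have hδ0 : 0 < δ := by
    have : ‖Γ‖ < 2 * τ⁻¹ := by
      rw [← div_eq_mul_inv, lt_div_iff₀ hτ]
      linarith
    linarith
  have hdesc : ∀ k, F (b (k + 1)) + δ * ‖b (k + 1) - b k‖ ^ 2 ≤ F (b k) := fun k => by
    set d := b (k + 1) - b k with hd
    have h1 := objective_add (J := J) (μ := μ) (u := u) hΓ (b k) d
    have h2 := hsub k (b k)
    have h3 : b k - b (k + 1) = -d := by rw [hd, neg_sub]
    have h4 : b k + τ • (u - Γ (b k)) - b (k + 1) = τ • (u - Γ (b k)) - d := by rw [hd]; abel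
    rw [h3, hg] at h2
    simp only [h4] at h2
    rw [inner_neg_right, real_inner_smul_left, inner_sub_left, real_inner_smul_left,
      real_inner_self_eq_norm_sq] at h2
    rw [hd, add_sub_cancel, ← hd] at h1
    have h5 : inner ℝ (Γ d) d ≤ ‖Γ‖ * ‖d‖ ^ 2 := by
      refine (real_inner_le_norm _ _).trans ?_
      rw [pow_two, ← mul_assoc]
      exact mul_le_mul_of_nonneg_right (Γ.le_opNorm d) (norm_nonneg _)
    have h6 := mul_le_mul_of_nonneg_left h2 hμ.le
    have h7 : μ * (J (b (k + 1)) + -((τ * μ)⁻¹ * (τ * inner ℝ (u - Γ (b k)) d - ‖d‖ ^ 2))) =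
        μ * J (b (k + 1)) - inner ℝ (u - Γ (b k)) d + τ⁻¹ * ‖d‖ ^ 2 := by
      field_simp
      ring
    rw [h7] at h6
    rw [hF, h1, hδ]
    linarith
  have hanti : Antitone fun k => F (b k) := antitone_nat_of_succ_le fun k => by
    have := hdesc k
    have : 0 ≤ δ * ‖b (k + 1) - b k‖ ^ 2 := by positivity
    linarith
  have hFc : Continuous F := by
    rw [hF]
    unfold objective
    fun_prop
  obtain ⟨m, hm⟩ := hFc.exists_forall_le hcoer
  have hbdd : BddBelow (Set.range fun k => F (b k)) := ⟨F m, by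
    rintro _ ⟨k, rfl⟩
    exact hm _⟩
  have hFlim := tendsto_atTop_ciInf hanti hbdd
  have hdiff : Tendsto (fun k => b (k + 1) - b k) atTop (𝓝 0) := by
    have h1 : Tendsto (fun k => δ⁻¹ * (F (b k) - F (b (k + 1)))) atTop (𝓝 0) := by
      have := (hFlim.sub (hFlim.comp (tendsto_add_atTop_nat 1))).const_mul δ⁻¹
      simpa using this
    have h2 : Tendsto (fun k => ‖b (k + 1) - b k‖ ^ 2) atTop (𝓝 0) := by
      refine squeeze_zero (fun k => by positivity) (fun k => ?_) h1
      rw [← div_eq_inv_mul, le_div_iff₀ hδ0]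
      have := hdesc k
      linarith
    rw [tendsto_zero_iff_norm_tendsto_zero]
    simpa using h2.sqrt
  have hball : ∃ R, ∀ k, b k ∈ Metric.closedBall (0 : E) R := by
    have h1 := hcoer.eventually_gt_atTop (F (b 0))
    rw [← Metric.cobounded_eq_cocompact] at h1
    have h2 : Bornology.IsBounded {x | F x ≤ F (b 0)} :=
      Bornology.isBounded_def.mpr (h1.mono fun x hx => not_le.mpr hx)
    obtain ⟨R, hR⟩ := h2.subset_closedBall 0
    exact ⟨R, fun k => hR (hanti (Nat.zero_le k))⟩
  obtain ⟨R, hR⟩ := hball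
  by_contra hcon
  obtain ⟨φ, hφ, hφO⟩ := extraction_of_frequently_atTop (not_eventually.mp hcon)
  obtain ⟨β, -, ψ, hψ, hβ⟩ := tendsto_subseq_of_bounded Metric.isBounded_closedBall
    fun n => hR (φ n)
  have hφψ : Tendsto (φ ∘ ψ) atTop atTop := hφ.tendsto_atTop.comp hψ.tendsto_atTop
  have hβ0 : Tendsto (fun n => b (φ (ψ n))) atTop (𝓝 β) := hβ
  have hβ1 : Tendsto (fun n => b (φ (ψ n) + 1)) atTop (𝓝 β) := by
    have := hβ0.add (hdiff.comp hφψ)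
    simpa using this
  -- Vanishing steps give `b k` and `b (k + 1)` the same limit `β`, leaving only the gradient part
  -- of `g k`; hence `β` is critical.
  have hglim : Tendsto (fun n => g (φ (ψ n))) atTop (𝓝 (μ⁻¹ • (u - Γ β))) := by
    have h1 : Tendsto (fun n => g (φ (ψ n))) atTop
        (𝓝 ((τ * μ)⁻¹ • (β + τ • (u - Γ β) - β))) :=
      (((hβ0.add (((tendsto_const_nhds (x := u)).sub
        ((Γ.continuous.tendsto β).comp hβ0)).const_smul τ)).sub hβ1).const_smul _)
    convert h1 using 2
    rw [add_sub_cancel_left, smul_smul]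
    congr 1
    field_simp
  have hmem := hcrit β (mem_subdiff_of_tendsto hJc hβ1 hglim fun n => hsub _)
  obtain ⟨n, hn⟩ := ((hβ1.prodMk_nhds hglim).eventually (hO.mem_nhds hmem)).exists
  exact hφO (ψ n) ⟨_, hsub _, hn⟩

theorem tendsto_objective_cocompact {J : E → ℝ} {μ : ℝ} (hμ : 0 < μ) {u β₀ : E} {Γ : E →L[ℝ] E}
    {a A : ℝ} (ha : 0 < a)
    (h : ∀ y : E, objective J μ u Γ β₀ + μ ^ 2 * (a * ‖y‖ - A) ≤
      objective J μ u Γ (β₀ + μ • y)) :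
    Tendsto (objective J μ u Γ) (cocompact E) atTop := by
  have h1 : Tendsto (fun β : E => ‖β‖ - ‖β₀‖) (cocompact E) atTop :=
    tendsto_atTop_add_const_right _ _ tendsto_norm_cocompact_atTop
  have h2 : Tendsto (fun β : E => objective J μ u Γ β₀ + μ ^ 2 * (a * (μ⁻¹ * (‖β‖ - ‖β₀‖)) - A))
      (cocompact E) atTop := by
    refine tendsto_atTop_add_const_left _ _ (Tendsto.const_mul_atTop (by positivity) ?_)
    exact tendsto_atTop_add_const_right _ _
      ((h1.const_mul_atTop (inv_pos.mpr hμ)).const_mul_atTop ha)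
  refine tendsto_atTop_mono (fun β => ?_) h2
  have h3 := h (μ⁻¹ • (β - β₀))
  rw [smul_inv_smul₀ hμ.ne', add_sub_cancel, norm_smul,
    Real.norm_of_nonneg (inv_nonneg.mpr hμ.le)] at h3
  refine le_trans ?_ h3
  gcongr
  exact norm_sub_norm_le β β₀

/-- Forward-Backward identifies the manifold, in a finite-dimensional Euclidean space. -/
theorem exists_eventually_forwardBackward_mem {J : E → ℝ} (hJ : ConvexOn ℝ Set.univ J) {M : Set E}
    {β₀ : E} (hM : IsPartlySmoothAt J M β₀) {Γ' : E →L[ℝ] E}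
    (hker : LinearMap.ker Γ'.toLinearMap ⊓ modelSpace J β₀ = ⊥)
    (hη : preCertificate J β₀ Γ' ∈ intrinsicInterior ℝ (subdiff J β₀)) :
    ∃ C : ℝ, 0 < C ∧ ∀ (μ : ℝ) (u : E) (Γ : E →L[ℝ] E), 0 < μ → Γ.IsPositive →
      max ‖Γ - Γ'‖ (max (‖u - Γ β₀‖ * μ⁻¹) μ) ≤ C → ∀ τ : ℝ, 0 < τ → τ * ‖Γ‖ < 2 → ∀ b : E,
      ∀ᶠ k in atTop, forwardBackward J μ u Γ τ b k ∈ M := by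
  have hJc : Continuous J := hJ.locallyLipschitz.continuous
  by_cases hΓ' : Γ'.IsPositive
  · set g := pinv (compress Γ' (modelSpace J β₀)) (modelVector J β₀)
    have hg : g ∈ modelSpace J β₀ := pinv_compress_mem _ _ _
    have hηg : Γ' g ∈ intrinsicInterior ℝ (subdiff J β₀) := hη
    obtain ⟨c, hc, hs⟩ := exists_add_mem_of_mem_intrinsicInterior hηg
    obtain ⟨C₁, hC₁, a, ha, A, hgrow⟩ := exists_growth hΓ' hker hc hg hs
    obtain ⟨O, hOM, hO, hmem⟩ := eventually_nhds_iff.mp (hM.eventually_mem hηg)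
    obtain ⟨C₂, hC₂, hcrit⟩ :=
      exists_forall_critical_mem hJc hΓ' hker hg hηg (hO.mem_nhds hmem)
    refine ⟨min C₁ C₂, lt_min hC₁ hC₂, fun μ u Γ hμ hΓ hmax τ hτ hτΓ b => ?_⟩
    simp only [max_le_iff, le_min_iff] at hmax
    obtain ⟨⟨h1, h3, -⟩, h2, h4, h5⟩ := hmax
    have hev := eventually_forwardBackward_mem hJ hμ hΓ hτ hτΓ
      (tendsto_objective_cocompact hμ ha (hgrow μ u Γ hμ hΓ h1 h3)) hO
      (hcrit μ u Γ hμ hΓ h2 h4 h5) b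
    -- The starting point carries no proximal subgradient, hence the index shift.
    rw [← map_add_atTop_eq_nat 1, eventually_map]
    filter_upwards [hev] with k ⟨ζ, hζ, hk⟩ using hOM _ hk hζ
  · obtain ⟨ε, hε, hball⟩ :=
      Metric.isOpen_iff.mp (isClosed_setOf_isPositive (E := E)).isOpen_compl Γ' hΓ'
    refine ⟨ε / 2, by positivity, fun μ u Γ hμ hΓ hmax => absurd hΓ (hball ?_)⟩
    rw [Metric.mem_ball, dist_eq_norm]
    linarith [(le_max_left _ _).trans hmax]

end ForwardBackward

end PartlySmooth

theorem theorem3 (p : ℕ) (J : EuclideanSpace ℝ (Fin p) → ℝ) (hJ : ConvexOn ℝ Set.univ J)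
    (M : Set (EuclideanSpace ℝ (Fin p))) (β₀ : EuclideanSpace ℝ (Fin p))
    (hM : PartlySmooth.IsLocallyPartlySmoothAt J M β₀)
    (Γ' : EuclideanSpace ℝ (Fin p) →L[ℝ] EuclideanSpace ℝ (Fin p))
    (hker : LinearMap.ker Γ'.toLinearMap ⊓ PartlySmooth.modelSpace J β₀ = ⊥)
    (hη : PartlySmooth.preCertificate J β₀ Γ' ∈
      intrinsicInterior ℝ (PartlySmooth.subdiff J β₀)) :
    ∃ C : ℝ, 0 < C ∧
      ∀ (μ : ℝ) (u : EuclideanSpace ℝ (Fin p))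
        (Γ : EuclideanSpace ℝ (Fin p) →L[ℝ] EuclideanSpace ℝ (Fin p)),
        0 < μ → Γ.IsPositive →
        max ‖Γ - Γ'‖ (max (‖u - Γ β₀‖ * μ⁻¹) μ) ≤ C →
        ∀ τ : ℝ, 0 < τ → τ * ‖Γ‖ < 2 →
        ∀ b : EuclideanSpace ℝ (Fin p),
          ∀ᶠ k in Filter.atTop, PartlySmooth.forwardBackward J μ u Γ τ b k ∈ M := by
  obtain ⟨U, hU, hsm⟩ := hM.partlySmooth
  exact PartlySmooth.exists_eventually_forwardBackward_mem hJ
    (hsm β₀ ⟨hM.mem, mem_of_mem_nhds hU⟩) hker hη
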